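/- Let $H$ be a finite graph without multiple edges but possibly with loops, having at least one edge (a loop counts), and let $\Lambda=\{\lambda_i : i\in V(H)\}$ be positive weights. For a finite simple graph $G$ with at least one vertex, let $\mathrm{Hom}(G,H)$ be the set of adjacency-preserving maps $f:V(G)\to V(H)$, and let $p_\Lambda$ be the probability distribution on $\mathrm{Hom}(G,H)$ (when this set is non-empty) with $p_\Lambda(f)$ proportional to $\prod_{v\in V(G)}\lambda_{f(v)}$. Put $s(k,f)=|f^{-1}(k)|/|V(G)|$ and $\bar p_\Lambda(k)=\frac{1}{|V(G)|}\sum_{v\in V(G)}p_\Lambda(f(v)=k)$. For $A,B\subseteq V(H)$ write $A\sim B$ if $uv\in E(H)$ for all $u\in A$, $v\in B$, and put $w_\Lambda(A)=\sum_{i\in A}\lambda_i$, $\eta=\max\{w_\Lambda(A)w_\Lambda(B): A\sim B\}$, and $\mathcal M=\{(A,B): A,B\subseteq V(H),\ A\sim B,\ w_\Lambda(A)w_\Lambda(B)=\eta\}$. For $k\in V(H)$ let $$a^+_\Lambda(k)=\frac{1}{2\eta}\max_{(A,B)\in\mathcal M}\bigl(w_\Lambda(A)\lambda_k\mathbf 1_{\{k\in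 B\}}+w_\Lambda(B)\lambda_k\mathbf 1_{\{k\in A\}}\bigr),$$ and let $a^-_\Lambda(k)$ be defined in the same way with $\min$ in place of $\max$. (1) There are a family $\{G_d\}_{d\ge1}$ of $d$-regular bipartite graphs, a function $g$ with $g(d)\to0$ as $d\to\infty$, and a constant $c>0$ (all depending on $H$ and $\Lambda$) such that for every $k\in V(H)$ and every $d\ge 1$, with $p_\Lambda$ taken on $\mathrm{Hom}(G_d,H)$, $$p_\Lambda\bigl(|s(k,f)-a^+_\Lambda(k)|\le g(d)\bigr)\ge c-g(d)\quad\text{and}\quad p_\Lambda\bigl(|s(k,f)-a^-_\Lambda(k)|\le g(d)\bigr)\ge c-g(d).$$ (2) There are a family $\{G'_d\}_{d\ge1}$ of $d$-regular bipartite graphs, a function $g$ with $g(d)\to0$ as $d\to\infty$, and for each $k\in V(H)$ a number $a_\Lambda(k)$ (not depending on $d$) with $a^-_\Lambda(k)\le a_\Lambda(k)\le a^+_\Lambda(k)$, such that for every $k\in V(H)$ and every $d\ge1$, with $p_\Lambda$ and $\bar p_\Lambda$ taken with respect to $G'_d$, $$p_\Lambda\bigl(|s(k,f)-a_\Lambda(k)|\le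 g(d)\bigr)\ge 1-g(d)\quad\text{and}\quad |\bar p_\Lambda(k)-a_\Lambda(k)|\le g(d).$$ -/

import Mathlib

open Filter Topology

/-- A graph without multiple edges but possibly with loops: a symmetric relation. -/
structure LoopGraph (W : Type*) where
  Adj : W → W → Prop
  symm : ∀ i j, Adj i j → Adj j i

namespace HColouring

open scoped Classical in
/-- `Hom(G, H)`, the set of `H`-colourings of `G`. -/
noncomputable def homs {V W : Type*} [Fintype V] [Fintype W]
    (G : SimpleGraph V) (H : LoopGraph W) : Finset (V → W) :=
  Finset.univ.filter fun f => ∀ u v, G.Adj u v → H.Adj (f u) (f v)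

/-- The weight `∏ᵥ lam (f v)` of a colouring. -/
noncomputable def weight {V W : Type*} [Fintype V] (lam : W → ℝ) (f : V → W) : ℝ :=
  ∏ v, lam (f v)

/-- The partition function. -/
noncomputable def partitionFn {V W : Type*} [Fintype V] [Fintype W]
    (G : SimpleGraph V) (H : LoopGraph W) (lam : W → ℝ) : ℝ :=
  ∑ f ∈ homs G H, weight lam f

open scoped Classical in
/-- The probability of the event `S` when `f ∈ Hom(G, H)` is chosen with probability
proportional to `weight lam f`. -/
noncomputable def prob {V W : Type*} [Fintype V] [Fintype W]
    (G : SimpleGraph V) (H : LoopGraph W) (lam : W → ℝ) (S : (V → W) → Prop) : ℝ :=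
  ∑ f ∈ (homs G H).filter S, weight lam f / partitionFn G H lam

open scoped Classical in
/-- `s(k, f)`, the proportion of vertices that `f` maps to `k`. -/
noncomputable def prop {V W : Type*} [Fintype V] (k : W) (f : V → W) : ℝ :=
  ((Finset.univ.filter fun v => f v = k).card : ℝ) / (Fintype.card V : ℝ)

/-- The average over the vertices `v` of the probability that `f v = k`. -/
noncomputable def meanProp {V W : Type*} [Fintype V] [Fintype W]
    (G : SimpleGraph V) (H : LoopGraph W) (lam : W → ℝ) (k : W) : ℝ :=
  (1 / (Fintype.card V : ℝ)) * ∑ v, prob G H lam (fun f => f v = k)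

/-- The total weight of a set of vertices of `H`. -/
noncomputable def setWeight {W : Type*} (lam : W → ℝ) (A : Finset W) : ℝ :=
  ∑ i ∈ A, lam i

open scoped Classical in
/-- The pairs `(A, B)` of vertex sets with every element of `A` adjacent to every
element of `B`. -/
noncomputable def completePairs {W : Type*} [Fintype W] (H : LoopGraph W) :
    Finset (Finset W × Finset W) :=
  Finset.univ.filter fun P => ∀ u ∈ P.1, ∀ v ∈ P.2, H.Adj u v

theorem completePairs_nonempty {W : Type*} [Fintype W] (H : LoopGraph W) :
    (completePairs H).Nonempty :=
  ⟨(∅, ∅), by simp [completePairs]⟩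

/-- The maximum of `w(A) w(B)` over the pairs with `A ∼ B`. -/
noncomputable def eta {W : Type*} [Fintype W] (H : LoopGraph W) (lam : W → ℝ) : ℝ :=
  (completePairs H).sup' (completePairs_nonempty H)
    fun P => setWeight lam P.1 * setWeight lam P.2

open scoped Classical in
/-- The pairs `(A, B)` with `A ∼ B` that attain the maximum `eta`. -/
noncomputable def maxPairs {W : Type*} [Fintype W] (H : LoopGraph W) (lam : W → ℝ) :
    Finset (Finset W × Finset W) :=
  (completePairs H).filter fun P => setWeight lam P.1 * setWeight lam P.2 = eta H lam

theorem maxPairs_nonempty {W : Type*} [Fintype W] (H : LoopGraph W) (lam : W → ℝ) :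
    (maxPairs H lam).Nonempty := by
  classical
  obtain ⟨P, hP, h⟩ := Finset.exists_mem_eq_sup' (completePairs_nonempty H)
    (fun P => setWeight lam P.1 * setWeight lam P.2)
  exact ⟨P, Finset.mem_filter.2 ⟨hP, h.symm⟩⟩

open scoped Classical in
/-- `w(A) lam k 1{k ∈ B} + w(B) lam k 1{k ∈ A}`. -/
noncomputable def pairValue {W : Type*} (lam : W → ℝ) (k : W) (P : Finset W × Finset W) : ℝ :=
  setWeight lam P.1 * lam k * (if k ∈ P.2 then 1 else 0) +
    setWeight lam P.2 * lam k * (if k ∈ P.1 then 1 else 0)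

/-- `a⁺(k)`. -/
noncomputable def aPlus {W : Type*} [Fintype W] (H : LoopGraph W) (lam : W → ℝ) (k : W) : ℝ :=
  (maxPairs H lam).sup' (maxPairs_nonempty H lam) (pairValue lam k) / (2 * eta H lam)

/-- `a⁻(k)`. -/
noncomputable def aMinus {W : Type*} [Fintype W] (H : LoopGraph W) (lam : W → ℝ) (k : W) : ℝ :=
  (maxPairs H lam).inf' (maxPairs_nonempty H lam) (pairValue lam k) / (2 * eta H lam)

open scoped Classical in
/-- `G` is a (nonempty, finite, simple) `d`-regular bipartite graph. -/
def IsRegularBipartite {V : Type*} [Fintype V] (G : SimpleGraph V) (d : ℕ) : Prop :=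
  Nonempty V ∧ G.IsBipartite ∧ G.IsRegularOfDegree d

end HColouring

/-! Colourings of $K_{d,d}$ are exactly the maps lying in some box $A^d\times B^d$ with $A\sim B$,
and such a box has weight $(w(A)w(B))^d$. Boxes of pairs in $\mathcal M$ each weigh $\eta^d$; all
others together are exponentially smaller. Pairs in $\mathcal M$ form an antichain, so maximal boxes
overlap only in colourings that also lie in smaller boxes, and the partition function is $(|\mathcal
M|+o(1))\eta^d$ (`abs_sum_homs_sub_le`, `tendsto_sum_homs_div`).

Inside one maximal box the vertex colours are independent, so the law of large numbers
(`one_sub_le_sum_prod`) concentrates $s(k,f)$ at the box mean `pairValue lam k P / (2 * eta H lam)`.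
Each maximal box carries asymptotic probability $1/|\mathcal M|$. Choosing a pair that attains the
maximum or the minimum gives (1) with $c=1/|\mathcal M|$.

For (2), take $d$ disjoint copies of $K_{d,d}$. The copies are coloured independently, so the same
law of large numbers concentrates $s(k,f)$ at the mean for $K_{d,d}$, which tends to the average of
the box means over $\mathcal M$ (`tendsto_meanProp`). -/

namespace HColouring

/-! ### Product distributions and a Chebyshev bound -/

section ProductWeights

variable {ι Ω : Type*} [Fintype ι] [DecidableEq ι] [Fintype Ω]

theorem sum_prod_eq_one {q : ι → Ω → ℝ} (hq1 : ∀ i, ∑ x, q i x = 1) :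
    ∑ w : ι → Ω, ∏ i, q i (w i) = 1 := by
  rw [← Fintype.prod_sum]
  simp [hq1]

theorem sum_prod_mul_apply {q : ι → Ω → ℝ} (hq1 : ∀ i, ∑ x, q i x = 1)
    (i : ι) (X : Ω → ℝ) :
    ∑ w : ι → Ω, (∏ l, q l (w l)) * X (w i) = ∑ x, q i x * X x := by
  have h : ∀ w : ι → Ω, (∏ l, q l (w l)) * X (w i) =
      ∏ l, q l (w l) * (if l = i then X (w l) else 1) := fun w => by
    rw [Finset.prod_mul_distrib]
    simp
  simp only [h]
  rw [← Fintype.prod_sum (fun l x => q l x * (if l = i then X x else 1)),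
    Finset.prod_eq_single i]
  · simp
  · intro l _ hl
    simp [hl, hq1]
  · simp

/-- Cross terms of the variance vanish: the sum factorises over coordinates, and the factor at `i`
is the mean of `Y i`. -/
theorem sum_prod_mul_apply_mul_apply {q : ι → Ω → ℝ} {Y : ι → Ω → ℝ}
    (hY : ∀ i, ∑ x, q i x * Y i x = 0) {i j : ι} (hij : i ≠ j) :
    ∑ w : ι → Ω, (∏ l, q l (w l)) * (Y i (w i) * Y j (w j)) = 0 := by
  have h : ∀ w : ι → Ω, (∏ l, q l (w l)) * (Y i (w i) * Y j (w j)) =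
      ∏ l, q l (w l) * ((if l = i then Y l (w l) else 1) *
        (if l = j then Y l (w l) else 1)) := fun w => by
    rw [Finset.prod_mul_distrib, Finset.prod_mul_distrib]
    simp
  simp only [h]
  rw [← Fintype.prod_sum (fun l x => q l x * ((if l = i then Y l x else 1) *
        (if l = j then Y l x else 1)))]
  exact Finset.prod_eq_zero (Finset.mem_univ i) (by simp [hij, hY])

/-- The second moment of a sum of independent centred variables bounded by `1`. -/
theorem sum_prod_mul_sq_le {q : ι → Ω → ℝ} {Y : ι → Ω → ℝ} (hq : ∀ i x, 0 ≤ q i x)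
    (hq1 : ∀ i, ∑ x, q i x = 1) (hY : ∀ i, ∑ x, q i x * Y i x = 0)
    (hY1 : ∀ i x, (Y i x) ^ 2 ≤ 1) :
    ∑ w : ι → Ω, (∏ l, q l (w l)) * (∑ i, Y i (w i)) ^ 2 ≤ Fintype.card ι := by
  have h : ∑ w : ι → Ω, (∏ l, q l (w l)) * (∑ i, Y i (w i)) ^ 2 =
      ∑ i, ∑ j, ∑ w : ι → Ω, (∏ l, q l (w l)) * (Y i (w i) * Y j (w j)) := by
    simp only [sq, Finset.sum_mul_sum]
    simp only [Finset.mul_sum]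
    rw [Finset.sum_comm]
    exact Finset.sum_congr rfl fun i _ => Finset.sum_comm
  have h2 : ∀ i, ∑ j, ∑ w : ι → Ω, (∏ l, q l (w l)) * (Y i (w i) * Y j (w j)) ≤ 1 := by
    intro i
    rw [Finset.sum_eq_single i (fun j _ hj => sum_prod_mul_apply_mul_apply hY hj.symm)
      (by simp), ← sum_prod_eq_one hq1]
    refine Finset.sum_le_sum fun w _ => mul_le_of_le_one_right
      (Finset.prod_nonneg fun l _ => hq l _) ?_
    simpa [sq] using hY1 i (w i)
  rw [h]
  calc _ ≤ ∑ _i : ι, (1 : ℝ) := Finset.sum_le_sum fun i _ => h2 i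
    _ = _ := by simp

theorem sum_prod_mul_average {q : ι → Ω → ℝ} {X : ι → Ω → ℝ} (hq1 : ∀ i, ∑ x, q i x = 1) :
    ∑ w : ι → Ω, (∏ l, q l (w l)) * ((∑ i, X i (w i)) / Fintype.card ι) =
      (∑ i, ∑ x, q i x * X i x) / Fintype.card ι := by
  simp only [← mul_div_assoc, ← Finset.sum_div, Finset.mul_sum]
  rw [Finset.sum_comm]
  simp only [sum_prod_mul_apply hq1]

open scoped Classical in
/-- Weak law of large numbers for independent variables with values in `[0, 1]`. -/
theorem one_sub_le_sum_prod [Nonempty ι] {q : ι → Ω → ℝ} {X : ι → Ω → ℝ}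
    (hq : ∀ i x, 0 ≤ q i x) (hq1 : ∀ i, ∑ x, q i x = 1)
    (hX0 : ∀ i x, 0 ≤ X i x) (hX1 : ∀ i x, X i x ≤ 1) {ε : ℝ} (hε : 0 < ε) :
    1 - 1 / (Fintype.card ι * ε ^ 2) ≤ ∑ w : ι → Ω,
      if |(∑ i, X i (w i)) / Fintype.card ι - (∑ i, ∑ x, q i x * X i x) / Fintype.card ι| ≤ ε
      then ∏ l, q l (w l) else 0 := by
  set m : ι → ℝ := fun i => ∑ x, q i x * X i x with hm
  have hn : (0 : ℝ) < Fintype.card ι := by exact_mod_cast Fintype.card_pos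
  have hm0 : ∀ i, 0 ≤ m i := fun i =>
    Finset.sum_nonneg fun x _ => mul_nonneg (hq i x) (hX0 i x)
  have hm1 : ∀ i, m i ≤ 1 := fun i => by
    rw [← hq1 i]
    exact Finset.sum_le_sum fun x _ => mul_le_of_le_one_right (hq i x) (hX1 i x)
  have key := sum_prod_mul_sq_le (Y := fun i x => X i x - m i) hq hq1
    (fun i => by simp [mul_sub, Finset.sum_sub_distrib, ← Finset.sum_mul, hq1, hm])
    (fun i x => by
      rw [sq_le_one_iff_abs_le_one, abs_le]
      constructor <;> linarith [hX0 i x, hX1 i x, hm0 i, hm1 i])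
  have hc : 0 < (Fintype.card ι : ℝ) ^ 2 * ε ^ 2 := by positivity
  -- Chebyshev pointwise: off the event the squared deviation divided by $n^2\varepsilon^2$ exceeds
  -- 1, so the left side is nonpositive there.
  have pt : ∀ w : ι → Ω, (∏ l, q l (w l)) -
      (∏ l, q l (w l)) * (∑ i, (X i (w i) - m i)) ^ 2 / ((Fintype.card ι : ℝ) ^ 2 * ε ^ 2) ≤
      if |(∑ i, X i (w i)) / Fintype.card ι - (∑ i, m i) / Fintype.card ι| ≤ ε
      then ∏ l, q l (w l) else 0 := by
    intro w
    have hp : 0 ≤ ∏ l, q l (w l) := Finset.prod_nonneg fun l _ => hq l _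
    split_ifs with h
    · have : 0 ≤ (∏ l, q l (w l)) * (∑ i, (X i (w i) - m i)) ^ 2 /
          ((Fintype.card ι : ℝ) ^ 2 * ε ^ 2) := by positivity
      linarith
    · rw [not_le, ← sub_div, ← Finset.sum_sub_distrib, abs_div, abs_of_pos hn,
        lt_div_iff₀ hn] at h
      rw [sub_nonpos, le_div_iff₀ hc]
      refine mul_le_mul_of_nonneg_left ?_ hp
      rw [← sq_abs (∑ i, _), ← mul_pow, mul_comm]
      exact pow_le_pow_left₀ (by positivity) h.le 2
  refine le_trans ?_ (Finset.sum_le_sum fun w _ => pt w)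
  rw [Finset.sum_sub_distrib, sum_prod_eq_one hq1, ← Finset.sum_div]
  refine sub_le_sub_left ?_ _
  rw [div_le_div_iff₀ hc (by positivity)]
  nlinarith [mul_le_mul_of_nonneg_right key (by positivity : 0 ≤ (Fintype.card ι : ℝ) * ε ^ 2)]

end ProductWeights

/-- The radius $\varepsilon=n^{-1/3}$ equals its own Chebyshev error $1/(n\varepsilon^2)$, so one
vanishing quantity controls both. -/
theorem rpow_neg_third_spec {n : ℝ} (hn : 0 < n) :
    1 / (n * (n ^ (-(1 / 3) : ℝ)) ^ 2) = n ^ (-(1 / 3) : ℝ) := by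
  have h : n * (n ^ (-(1 / 3) : ℝ)) ^ 3 = 1 := by
    rw [← Real.rpow_natCast, ← Real.rpow_mul hn.le]
    norm_num [Real.rpow_neg_one]
    exact mul_inv_cancel₀ hn.ne'
  have hp : 0 < n ^ (-(1 / 3) : ℝ) := Real.rpow_pos_of_pos hn _
  rw [div_eq_iff (by positivity)]
  linarith

theorem tendsto_rpow_neg_third :
    Tendsto (fun d : ℕ => (d : ℝ) ^ (-(1 / 3) : ℝ)) atTop (𝓝 0) :=
  (tendsto_rpow_neg_atTop (by norm_num)).comp tendsto_natCast_atTop_atTop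

/-! ### Weights and colour proportions -/

section Colourings

variable {V W : Type*} [Fintype V] {lam : W → ℝ}

theorem weight_pos (hlam : ∀ i, 0 < lam i) (f : V → W) : 0 < weight lam f :=
  Finset.prod_pos fun v _ => hlam (f v)

open scoped Classical in
theorem prop_eq (k : W) (f : V → W) :
    prop k f = (∑ v, if f v = k then (1 : ℝ) else 0) / Fintype.card V := by
  simp [prop]

theorem prop_nonneg (k : W) (f : V → W) : 0 ≤ prop k f := by
  unfold prop; positivity

theorem prop_le_one (k : W) (f : V → W) : prop k f ≤ 1 := by
  unfold prop
  exact div_le_one_of_le₀ (by exact_mod_cast Finset.card_le_univ _) (by positivity)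

end Colourings

/-! ### The colouring distribution on all maps -/

section Gibbs

variable {V W : Type*} [Fintype V] [Fintype W] (G : SimpleGraph V) (H : LoopGraph W)
  (lam : W → ℝ)

open scoped Classical in
/-- The distribution `p_Λ` on all maps `V → W`, zero outside `Hom(G, H)`. -/
noncomputable def gibbs (f : V → W) : ℝ :=
  if f ∈ homs G H then weight lam f / partitionFn G H lam else 0

variable {lam}

theorem partitionFn_nonneg (hlam : ∀ i, 0 < lam i) : 0 ≤ partitionFn G H lam :=
  Finset.sum_nonneg fun f _ => (weight_pos hlam f).le

theorem gibbs_nonneg (hlam : ∀ i, 0 < lam i) (f : V → W) : 0 ≤ gibbs G H lam f := by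
  unfold gibbs
  split_ifs
  · exact div_nonneg (weight_pos hlam f).le (partitionFn_nonneg G H hlam)
  · exact le_rfl

variable (lam)

variable [DecidableEq V]

theorem sum_gibbs_mul (h : (V → W) → ℝ) :
    ∑ f, gibbs G H lam f * h f = (∑ f ∈ homs G H, weight lam f * h f) / partitionFn G H lam := by
  classical
  rw [Finset.sum_div, ← Finset.sum_filter_add_sum_filter_not Finset.univ (· ∈ homs G H)]
  rw [Finset.sum_eq_zero (s := Finset.univ.filter fun f => f ∉ homs G H), add_zero]
  · rw [Finset.filter_mem_eq_inter, Finset.univ_inter]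
    refine Finset.sum_congr (by congr) fun f hf => ?_
    rw [gibbs, if_pos hf]
    ring
  · intro f hf
    rw [gibbs, if_neg (Finset.mem_filter.1 hf).2, zero_mul]

theorem sum_gibbs (hZ : partitionFn G H lam ≠ 0) :
    ∑ f, gibbs G H lam f = 1 := by
  have := sum_gibbs_mul G H lam (fun _ => 1)
  simp only [mul_one] at this
  rw [this]
  exact div_self hZ

theorem prob_eq_sum_gibbs (S : (V → W) → Prop) [DecidablePred S] :
    prob G H lam S = ∑ f, if S f then gibbs G H lam f else 0 := by
  classical
  have h : ∀ f, (if S f then gibbs G H lam f else 0) =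
      if f ∈ (homs G H).filter S then weight lam f / partitionFn G H lam else 0 := fun f => by
    simp only [gibbs, Finset.mem_filter]
    split_ifs <;> tauto
  simp only [h, prob]
  rw [Finset.sum_ite_mem, Finset.univ_inter]
  refine Finset.sum_congr ?_ fun _ _ => rfl
  congr

theorem meanProp_eq_sum_gibbs (k : W) :
    meanProp G H lam k = ∑ f, gibbs G H lam f * prop k f := by
  classical
  simp only [meanProp, prob_eq_sum_gibbs, prop_eq]
  rw [Finset.sum_comm, Finset.mul_sum]
  refine Finset.sum_congr rfl fun f _ => ?_
  rw [← mul_div_assoc, Finset.mul_sum, Finset.mul_sum, one_div, div_eq_inv_mul, Finset.mul_sum]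
  simp only [mul_ite, mul_one, mul_zero]

end Gibbs

/-! ### Disjoint copies of a graph -/

section Copies

variable {ι U W : Type*} [Fintype ι] [Fintype U] (G : SimpleGraph U) (H : LoopGraph W)
  (lam : W → ℝ)

theorem weight_curry (f : ι × U → W) :
    weight lam f = ∏ i, weight lam fun u => f (i, u) := by
  simp [weight, Fintype.prod_prod_type]

theorem prop_curry (k : W) (f : ι × U → W) :
    prop k f = (∑ i, prop k fun u => f (i, u)) / Fintype.card ι := by
  simp only [prop_eq, Fintype.sum_prod_type, ← Finset.sum_div, Fintype.card_prod, Nat.cast_mul]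
  rw [div_div, mul_comm]

variable [Fintype W]

theorem mem_homs {V : Type*} [Fintype V] {G : SimpleGraph V} {H : LoopGraph W} {f : V → W} :
    f ∈ homs G H ↔ ∀ u v, G.Adj u v → H.Adj (f u) (f v) := by
  simp [homs]

/-- The box product with the edgeless graph on `ι` is a disjoint union of copies of `G`, so no
constraint links two copies. -/
theorem mem_homs_boxProd_bot (f : ι × U → W) :
    f ∈ homs ((⊥ : SimpleGraph ι) □ G) H ↔ ∀ i, (fun u => f (i, u)) ∈ homs G H := by
  simp only [mem_homs, SimpleGraph.boxProd_adj, SimpleGraph.bot_adj, false_and, false_or]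
  constructor
  · intro h i u v huv
    exact h (i, u) (i, v) ⟨huv, rfl⟩
  · rintro h ⟨i, u⟩ ⟨j, v⟩ ⟨huv, hij⟩
    obtain rfl : i = j := hij
    exact h i u v huv

variable [DecidableEq ι] [DecidableEq U]

theorem partitionFn_eq_sum_ite {V : Type*} [Fintype V] [DecidableEq V] (G : SimpleGraph V)
    [DecidableEq W] :
    partitionFn G H lam = ∑ f, if f ∈ homs G H then weight lam f else 0 := by
  rw [partitionFn, Finset.sum_ite_mem, Finset.univ_inter]

open scoped Classical in
theorem partitionFn_boxProd_bot :
    partitionFn ((⊥ : SimpleGraph ι) □ G) H lam = partitionFn G H lam ^ Fintype.card ι := by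
  rw [partitionFn_eq_sum_ite, partitionFn_eq_sum_ite]
  rw [← Finset.card_univ, ← Finset.prod_const, Fintype.prod_sum, ← (Equiv.curry ι U W).sum_comp]
  refine Finset.sum_congr (by congr) fun f _ => ?_
  simp only [mem_homs_boxProd_bot, weight_curry, Finset.prod_ite_zero, Finset.mem_univ,
    forall_const]
  rfl

-- Independence of the copies: this lets the results on product distributions apply with whole
-- colourings of `G` as outcomes.
open scoped Classical in
theorem gibbs_boxProd_bot (f : ι × U → W) :
    gibbs ((⊥ : SimpleGraph ι) □ G) H lam f = ∏ i, gibbs G H lam fun u => f (i, u) := by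
  simp only [gibbs, Finset.prod_ite_zero, mem_homs_boxProd_bot, weight_curry,
    partitionFn_boxProd_bot, Finset.prod_div_distrib, Finset.prod_const, Finset.card_univ]
  simp

variable {lam}

theorem meanProp_boxProd_bot [Nonempty ι] (hZ : partitionFn G H lam ≠ 0) (k : W) :
    meanProp ((⊥ : SimpleGraph ι) □ G) H lam k = meanProp G H lam k := by
  have hn : (Fintype.card ι : ℝ) ≠ 0 := by exact_mod_cast Fintype.card_ne_zero
  simp only [meanProp_eq_sum_gibbs, gibbs_boxProd_bot, prop_curry]
  rw [← (Equiv.curry ι U W).symm.sum_comp]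
  have := sum_prod_mul_average (ι := ι) (q := fun _ => gibbs G H lam) (X := fun _ f => prop k f)
    (fun _ => sum_gibbs G H lam hZ)
  simp only [Equiv.curry_symm_apply, Function.uncurry_apply_pair]
  rw [this]
  simp only [Finset.sum_const, Finset.card_univ, nsmul_eq_mul]
  field_simp

theorem one_sub_le_prob_boxProd_bot [Nonempty ι] (hlam : ∀ i, 0 < lam i)
    (hZ : partitionFn G H lam ≠ 0) (k : W) {ε : ℝ} (hε : 0 < ε) :
    1 - 1 / (Fintype.card ι * ε ^ 2) ≤ prob ((⊥ : SimpleGraph ι) □ G) H lam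
      fun f => |prop k f - meanProp G H lam k| ≤ ε := by
  classical
  have hn : (Fintype.card ι : ℝ) ≠ 0 := by exact_mod_cast Fintype.card_ne_zero
  have := one_sub_le_sum_prod (ι := ι) (q := fun _ => gibbs G H lam) (X := fun _ f => prop k f)
    (fun _ => gibbs_nonneg G H hlam) (fun _ => sum_gibbs G H lam hZ)
    (fun _ => prop_nonneg k) (fun _ => prop_le_one k) hε
  refine this.trans_eq ?_
  rw [prob_eq_sum_gibbs, ← Equiv.sum_comp (Equiv.curry ι U W).symm (fun f => ite _ _ _)]
  refine Finset.sum_congr rfl fun f _ => ?_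
  simp only [gibbs_boxProd_bot, prop_curry, Equiv.curry_symm_apply, Function.uncurry_apply_pair,
    Finset.sum_const, Finset.card_univ, nsmul_eq_mul, ← meanProp_eq_sum_gibbs,
    mul_div_cancel_left₀ _ hn]

end Copies

end HColouring

namespace HColouring

/-! ### Pairs attaining the maximum -/

section Pairs

variable {W : Type*} {H : LoopGraph W} {lam : W → ℝ}

theorem setWeight_nonneg (hlam : ∀ i, 0 < lam i) (A : Finset W) : 0 ≤ setWeight lam A :=
  Finset.sum_nonneg fun i _ => (hlam i).le

theorem setWeight_mono (hlam : ∀ i, 0 < lam i) {A B : Finset W} (h : A ⊆ B) :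
    setWeight lam A ≤ setWeight lam B :=
  Finset.sum_le_sum_of_subset_of_nonneg h fun i _ _ => (hlam i).le

theorem eq_of_subset_of_setWeight_le (hlam : ∀ i, 0 < lam i) {A B : Finset W} (h : A ⊆ B)
    (hw : setWeight lam B ≤ setWeight lam A) : A = B := by
  refine h.antisymm fun i hi => ?_
  by_contra hiA
  exact hw.not_gt (Finset.sum_lt_sum_of_subset h hi hiA (hlam i) fun j _ _ => (hlam j).le)

variable [Fintype W]

theorem mem_completePairs {P : Finset W × Finset W} :
    P ∈ completePairs H ↔ ∀ u ∈ P.1, ∀ v ∈ P.2, H.Adj u v := by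
  simp [completePairs]

theorem mem_maxPairs {P : Finset W × Finset W} :
    P ∈ maxPairs H lam ↔
      P ∈ completePairs H ∧ setWeight lam P.1 * setWeight lam P.2 = eta H lam := by
  simp [maxPairs]

theorem le_eta {P : Finset W × Finset W} (hP : P ∈ completePairs H) :
    setWeight lam P.1 * setWeight lam P.2 ≤ eta H lam :=
  Finset.le_sup' (fun P : Finset W × Finset W => setWeight lam P.1 * setWeight lam P.2) hP

theorem eta_pos (hH : ∃ i j, H.Adj i j) (hlam : ∀ i, 0 < lam i) : 0 < eta H lam := by
  obtain ⟨i, j, hij⟩ := hH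
  have h : (({i}, {j}) : Finset W × Finset W) ∈ completePairs H := by
    simp [mem_completePairs, hij]
  refine lt_of_lt_of_le ?_ (le_eta h)
  simpa [setWeight] using mul_pos (hlam i) (hlam j)

theorem setWeight_pos_of_mem_maxPairs (hη : 0 < eta H lam) (hlam : ∀ i, 0 < lam i)
    {P : Finset W × Finset W} (hP : P ∈ maxPairs H lam) :
    0 < setWeight lam P.1 ∧ 0 < setWeight lam P.2 := by
  have h := (mem_maxPairs.1 hP).2 ▸ hη
  exact ⟨pos_of_mul_pos_left h (setWeight_nonneg hlam _),
    pos_of_mul_pos_right h (setWeight_nonneg hlam _)⟩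

/-- The pairs attaining the maximum form an antichain. -/
theorem eq_of_subset_of_mem_maxPairs (hη : 0 < eta H lam) (hlam : ∀ i, 0 < lam i)
    {P Q : Finset W × Finset W} (hP : P ∈ maxPairs H lam) (hQ : Q ∈ maxPairs H lam)
    (h1 : Q.1 ⊆ P.1) (h2 : Q.2 ⊆ P.2) : Q = P := by
  have hPQ := (mem_maxPairs.1 hP).2.trans (mem_maxPairs.1 hQ).2.symm
  obtain ⟨hQ1, hQ2⟩ := setWeight_pos_of_mem_maxPairs hη hlam hQ
  have m1 := setWeight_mono hlam h1
  have m2 := setWeight_mono hlam h2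
  refine Prod.ext (eq_of_subset_of_setWeight_le hlam h1 ?_)
    (eq_of_subset_of_setWeight_le hlam h2 ?_)
  · by_contra! h
    exact hPQ.not_gt (mul_lt_mul h m2 hQ2 (setWeight_nonneg hlam _))
  · by_contra! h
    exact hPQ.not_gt (mul_lt_mul' m1 h hQ2.le (hQ1.trans_le m1))

end Pairs

/-! ### Decomposing the colourings of $K_{d,d}$ into boxes -/

section Boxes

variable {W : Type*} {H : LoopGraph W} {lam : W → ℝ} {d : ℕ}

/-- The set of values allowed at a vertex of `K_{d,d}` for colourings with
sides mapped into `P.1` and `P.2`. -/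
def sideSet (P : Finset W × Finset W) (v : Fin d ⊕ Fin d) : Finset W :=
  Sum.elim (fun _ => P.1) (fun _ => P.2) v

theorem mem_box {P : Finset W × Finset W} {f : Fin d ⊕ Fin d → W} :
    f ∈ Fintype.piFinset (sideSet P) ↔ (∀ i, f (.inl i) ∈ P.1) ∧ ∀ i, f (.inr i) ∈ P.2 := by
  simp [Fintype.mem_piFinset, sideSet]

theorem sum_box_weight (P : Finset W × Finset W) :
    ∑ f ∈ Fintype.piFinset (sideSet (d := d) P), weight lam f =
      (setWeight lam P.1 * setWeight lam P.2) ^ d := by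
  simp only [weight]
  rw [← Finset.prod_univ_sum (sideSet P) fun _ i => lam i]
  simp [Fintype.prod_sum_type, sideSet, setWeight, mul_pow]

/-- The distribution of a vertex colour, proportional to the weights, in the box of `P`. -/
noncomputable def boxWeight [DecidableEq W] (lam : W → ℝ) (P : Finset W × Finset W)
    (v : Fin d ⊕ Fin d) (x : W) : ℝ :=
  if x ∈ sideSet P v then lam x / setWeight lam (sideSet P v) else 0

theorem boxWeight_nonneg [DecidableEq W] {P : Finset W × Finset W} (hlam : ∀ i, 0 < lam i) (v : Fin d ⊕ Fin d) (x : W) :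
    0 ≤ boxWeight lam P v x := by
  unfold boxWeight
  split_ifs
  · exact div_nonneg (hlam x).le (setWeight_nonneg hlam _)
  · exact le_rfl

variable [Fintype W]

theorem mem_homs_completeBipartiteGraph {f : Fin d ⊕ Fin d → W} :
    f ∈ homs (completeBipartiteGraph (Fin d) (Fin d)) H ↔
      ∀ i j, H.Adj (f (.inl i)) (f (.inr j)) := by
  rw [mem_homs]
  constructor
  · intro h i j
    exact h _ _ (by simp)
  · rintro h (i | i) (j | j) hij
    · simp at hij
    · exact h i j
    · exact H.symm _ _ (h j i)
    · simp at hij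

theorem mem_homs_of_mem_box {P : Finset W × Finset W} (hP : P ∈ completePairs H)
    {f : Fin d ⊕ Fin d → W} (hf : f ∈ Fintype.piFinset (sideSet P)) :
    f ∈ homs (completeBipartiteGraph (Fin d) (Fin d)) H := by
  rw [mem_box] at hf
  exact mem_homs_completeBipartiteGraph.2 fun i j =>
    mem_completePairs.1 hP _ (hf.1 i) _ (hf.2 j)

/-- The images of the two sides form the least pair `Q` whose box contains `f`. If `Q` is maximal,
the antichain property makes it the only maximal pair whose box contains `f`, and the difference is
0. Otherwise `f` lies in a non-maximal box, and the crude bound $|\mathcal M|+1$ suffices. -/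
theorem abs_indicator_homs_sub_le [DecidableEq W] (hη : 0 < eta H lam) (hlam : ∀ i, 0 < lam i)
    (f : Fin d ⊕ Fin d → W) :
    |(if f ∈ homs (completeBipartiteGraph (Fin d) (Fin d)) H then (1 : ℝ) else 0) -
        ∑ P ∈ maxPairs H lam, if f ∈ Fintype.piFinset (sideSet P) then 1 else 0| ≤
      ((maxPairs H lam).card + 1) * ∑ P ∈ completePairs H \ maxPairs H lam,
        if f ∈ Fintype.piFinset (sideSet P) then 1 else 0 := by
  have nn : ∀ P : Finset W × Finset W,
      (0 : ℝ) ≤ if f ∈ Fintype.piFinset (sideSet P) then 1 else 0 := fun P => by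
    split_ifs <;> norm_num
  have hr : (0 : ℝ) ≤ ((maxPairs H lam).card + 1) * ∑ P ∈ completePairs H \ maxPairs H lam,
      if f ∈ Fintype.piFinset (sideSet P) then 1 else 0 :=
    mul_nonneg (by positivity) (Finset.sum_nonneg fun P _ => nn P)
  by_cases hf : f ∈ homs (completeBipartiteGraph (Fin d) (Fin d)) H
  · rw [if_pos hf]
    let Q : Finset W × Finset W :=
      (Finset.univ.image fun i => f (.inl i), Finset.univ.image fun i => f (.inr i))
    have hQf : f ∈ Fintype.piFinset (sideSet Q) := mem_box.2 (by simp [Q])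
    have hQ : Q ∈ completePairs H := by
      simpa [mem_completePairs, Q] using mem_homs_completeBipartiteGraph.1 hf
    by_cases hQM : Q ∈ maxPairs H lam
    · rw [Finset.sum_eq_single_of_mem Q hQM, if_pos hQf, sub_self, abs_zero]
      · exact hr
      · intro P hP hPQ
        refine if_neg fun hfP => hPQ ?_
        rw [mem_box] at hfP
        exact (eq_of_subset_of_mem_maxPairs hη hlam hP hQM
          (by simpa [Q, Finset.image_subset_iff] using hfP.1)
          (by simpa [Q, Finset.image_subset_iff] using hfP.2)).symm
    · have h1 : (1 : ℝ) ≤ ∑ P ∈ completePairs H \ maxPairs H lam,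
          if f ∈ Fintype.piFinset (sideSet P) then 1 else 0 := by
        refine le_trans (by rw [if_pos hQf]) (Finset.single_le_sum (fun P _ => nn P)
          (Finset.mem_sdiff.2 ⟨hQ, hQM⟩))
      have h2 : ∑ P ∈ maxPairs H lam, (if f ∈ Fintype.piFinset (sideSet P) then (1 : ℝ) else 0) ≤
          (maxPairs H lam).card := by
        rw [Finset.sum_boole]
        exact_mod_cast Finset.card_filter_le _ _
      have h3 := Finset.sum_nonneg fun P (_ : P ∈ maxPairs H lam) => nn P
      have h4 : (0 : ℝ) ≤ (maxPairs H lam).card := by positivity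
      rw [abs_le]
      constructor <;> nlinarith
  · rw [if_neg hf, Finset.sum_eq_zero, sub_self, abs_zero]
    · exact hr
    · exact fun P hP => if_neg fun h => hf (mem_homs_of_mem_box (mem_maxPairs.1 hP).1 h)

theorem sum_box_eq_sum_ite [DecidableEq W] (P : Finset W × Finset W)
    (h : (Fin d ⊕ Fin d → W) → ℝ) :
    ∑ f ∈ Fintype.piFinset (sideSet P), h f =
      ∑ f, h f * if f ∈ Fintype.piFinset (sideSet P) then 1 else 0 := by
  simp only [mul_ite, mul_one, mul_zero]
  rw [Finset.sum_ite_mem, Finset.univ_inter]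

/-- Up to colourings inside pairs that do not attain the maximum, a sum over
`Hom(K_{d,d}, H)` splits into the boxes of the pairs that do. -/
theorem abs_sum_homs_sub_le [DecidableEq W] (hη : 0 < eta H lam) (hlam : ∀ i, 0 < lam i)
    {h : (Fin d ⊕ Fin d → W) → ℝ} (h0 : ∀ f, 0 ≤ h f) (h1 : ∀ f, h f ≤ 1) :
    |∑ f ∈ homs (completeBipartiteGraph (Fin d) (Fin d)) H, weight lam f * h f -
        ∑ P ∈ maxPairs H lam, ∑ f ∈ Fintype.piFinset (sideSet P), weight lam f * h f| ≤
      ((maxPairs H lam).card + 1) * ∑ P ∈ completePairs H \ maxPairs H lam,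
        (setWeight lam P.1 * setWeight lam P.2) ^ d := by
  have e1 : ∑ f ∈ homs (completeBipartiteGraph (Fin d) (Fin d)) H, weight lam f * h f =
      ∑ f, weight lam f * h f *
        if f ∈ homs (completeBipartiteGraph (Fin d) (Fin d)) H then 1 else 0 := by
    simp only [mul_ite, mul_one, mul_zero]
    rw [Finset.sum_ite_mem, Finset.univ_inter]
  have e2 : ∑ P ∈ completePairs H \ maxPairs H lam, (setWeight lam P.1 * setWeight lam P.2) ^ d =
      ∑ f : Fin d ⊕ Fin d → W, weight lam f * ∑ P ∈ completePairs H \ maxPairs H lam,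
        if f ∈ Fintype.piFinset (sideSet P) then 1 else 0 := by
    simp only [← sum_box_weight, sum_box_eq_sum_ite]
    rw [Finset.sum_comm]
    simp only [Finset.mul_sum]
  rw [e1, e2]
  simp only [sum_box_eq_sum_ite]
  rw [Finset.sum_comm (s := maxPairs H lam)]
  simp only [← Finset.mul_sum]
  rw [← Finset.sum_sub_distrib, Finset.mul_sum]
  refine (Finset.abs_sum_le_sum_abs _ _).trans (Finset.sum_le_sum fun f _ => ?_)
  rw [← mul_sub, abs_mul, abs_of_nonneg (mul_nonneg (weight_pos hlam f).le (h0 f)), mul_left_comm]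
  exact mul_le_mul (mul_le_of_le_one_right (weight_pos hlam f).le (h1 f))
    (abs_indicator_homs_sub_le hη hlam f) (abs_nonneg _) (weight_pos hlam f).le

theorem tendsto_error (hη : 0 < eta H lam) (hlam : ∀ i, 0 < lam i) [DecidableEq W] :
    Tendsto (fun d : ℕ => (((maxPairs H lam).card : ℝ) + 1) *
      (∑ P ∈ completePairs H \ maxPairs H lam, (setWeight lam P.1 * setWeight lam P.2) ^ d) /
        eta H lam ^ d) atTop (𝓝 0) := by
  simp only [mul_div_assoc (((maxPairs H lam).card : ℝ) + 1), Finset.sum_div, ← div_pow]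
  rw [← mul_zero (((maxPairs H lam).card : ℝ) + 1), ← Finset.sum_const_zero]
  refine (tendsto_finsetSum _ fun P hP => ?_).const_mul _
  obtain ⟨hP, hPM⟩ := Finset.mem_sdiff.1 hP
  refine tendsto_pow_atTop_nhds_zero_of_lt_one
    (div_nonneg (mul_nonneg (setWeight_nonneg hlam _) (setWeight_nonneg hlam _)) hη.le) ?_
  rw [div_lt_one hη]
  exact lt_of_le_of_ne (le_eta hP) fun h => hPM (mem_maxPairs.2 ⟨hP, h⟩)

/-- Used with `h = 1` for the partition function and `h = prop k` for the mean. The box sums are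
required only for `1 ≤ d`, since proportions degenerate on an empty graph. -/
theorem tendsto_sum_homs_div [DecidableEq W] (hη : 0 < eta H lam) (hlam : ∀ i, 0 < lam i)
    {h : ∀ d : ℕ, (Fin d ⊕ Fin d → W) → ℝ} (h0 : ∀ d f, 0 ≤ h d f) (h1 : ∀ d f, h d f ≤ 1)
    {a : ℝ} (ha : ∀ d, 1 ≤ d → ∑ P ∈ maxPairs H lam,
      ∑ f ∈ Fintype.piFinset (sideSet P), weight lam f * h d f = a * eta H lam ^ d) :
    Tendsto (fun d : ℕ => (∑ f ∈ homs (completeBipartiteGraph (Fin d) (Fin d)) H,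
      weight lam f * h d f) / eta H lam ^ d) atTop (𝓝 a) := by
  rw [tendsto_iff_dist_tendsto_zero]
  refine squeeze_zero' (Eventually.of_forall fun d => dist_nonneg) ?_ (tendsto_error hη hlam)
  filter_upwards [eventually_ge_atTop 1] with d hd
  have hp : 0 < eta H lam ^ d := pow_pos hη d
  have := abs_sum_homs_sub_le hη hlam (h0 d) (h1 d)
  rw [ha d hd] at this
  rw [Real.dist_eq, div_sub' hp.ne', abs_div, abs_of_pos hp, mul_comm (eta H lam ^ d)]
  exact div_le_div_of_nonneg_right this hp.le

variable [DecidableEq W] {P : Finset W × Finset W}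

theorem sum_boxWeight (hη : 0 < eta H lam) (hlam : ∀ i, 0 < lam i) (hP : P ∈ maxPairs H lam)
    (v : Fin d ⊕ Fin d) : ∑ x, boxWeight lam P v x = 1 := by
  have hv : 0 < setWeight lam (sideSet P v) := by
    obtain ⟨h1, h2⟩ := setWeight_pos_of_mem_maxPairs hη hlam hP
    cases v
    · exact h1
    · exact h2
  simp only [boxWeight, Finset.sum_ite_mem, Finset.univ_inter]
  rw [← Finset.sum_div]
  exact div_self hv.ne'

/-- The normalising constant is $(w(A)w(B))^d=\eta^d$, the same for every maximal pair. -/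
theorem prod_boxWeight (hP : P ∈ maxPairs H lam) (f : Fin d ⊕ Fin d → W) :
    ∏ v, boxWeight lam P v (f v) =
      if f ∈ Fintype.piFinset (sideSet P) then weight lam f / eta H lam ^ d else 0 := by
  have h : ∏ v : Fin d ⊕ Fin d, setWeight lam (sideSet P v) = eta H lam ^ d := by
    rw [← (mem_maxPairs.1 hP).2]
    simp [Fintype.prod_sum_type, sideSet, mul_pow]
  simp only [boxWeight, Finset.prod_ite_zero, Finset.prod_div_distrib, h, Fintype.mem_piFinset,
    weight, Finset.mem_univ, forall_const]

/-- Half of the vertices lie on each side, so the mean is half of $\lambda_k\mathbf 1_{k\in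
A}/w(A)+\lambda_k\mathbf 1_{k\in B}/w(B)$; the common denominator is $\eta$. -/
theorem average_boxWeight (hη : 0 < eta H lam) (hlam : ∀ i, 0 < lam i)
    (hP : P ∈ maxPairs H lam) (hd : 1 ≤ d) (k : W) :
    (∑ v : Fin d ⊕ Fin d, ∑ x, boxWeight lam P v x * if x = k then 1 else 0) /
      Fintype.card (Fin d ⊕ Fin d) = pairValue lam k P / (2 * eta H lam) := by
  obtain ⟨h1, h2⟩ := setWeight_pos_of_mem_maxPairs hη hlam hP
  have hd' : (d : ℝ) ≠ 0 := by exact_mod_cast (by omega : d ≠ 0)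
  rw [← (mem_maxPairs.1 hP).2]
  have h : ∀ v : Fin d ⊕ Fin d, ∑ x, boxWeight lam P v x * (if x = k then 1 else 0) =
      boxWeight lam P v k := fun v => by simp
  have hl : ∀ i : Fin d, boxWeight lam P (.inl i) k =
      if k ∈ P.1 then lam k / setWeight lam P.1 else 0 := fun i => rfl
  have hr : ∀ i : Fin d, boxWeight lam P (.inr i) k =
      if k ∈ P.2 then lam k / setWeight lam P.2 else 0 := fun i => rfl
  simp only [h, Fintype.sum_sum_type, hl, hr, Finset.sum_const, Finset.card_univ, Fintype.card_fin, nsmul_eq_mul, Fintype.card_sum,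
    Nat.cast_add, pairValue]
  by_cases hk1 : k ∈ P.1 <;> by_cases hk2 : k ∈ P.2 <;> simp only [hk1, hk2, if_true, if_false] <;>
    field_simp <;> ring_nf

theorem sum_box_weight_mul_prop (hη : 0 < eta H lam) (hlam : ∀ i, 0 < lam i)
    (hP : P ∈ maxPairs H lam) (hd : 1 ≤ d) (k : W) :
    ∑ f ∈ Fintype.piFinset (sideSet (d := d) P), weight lam f * prop k f =
      pairValue lam k P / (2 * eta H lam) * eta H lam ^ d := by
  classical
  have := sum_prod_mul_average (ι := Fin d ⊕ Fin d) (q := boxWeight lam P)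
    (X := fun _ x => if x = k then 1 else 0) (sum_boxWeight hη hlam hP)
  rw [average_boxWeight hη hlam hP hd] at this
  rw [← this, Finset.sum_mul, sum_box_eq_sum_ite]
  refine Finset.sum_congr rfl fun f _ => ?_
  have hp : eta H lam ^ d ≠ 0 := (pow_pos hη d).ne'
  rw [prod_boxWeight hP, prop_eq]
  have e : ∀ v, (@ite ℝ (f v = k) (Classical.propDecidable _) 1 0) = if f v = k then 1 else 0 :=
    fun v => by congr
  simp only [e]
  split_ifs
  · field_simp
  · simp

/-- On the box of `P` the colouring distribution is the product law times $\eta^d/Z$; colourings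
outside the box are discarded. -/
theorem sub_le_prob_completeBipartiteGraph (hη : 0 < eta H lam) (hlam : ∀ i, 0 < lam i)
    (hP : P ∈ maxPairs H lam) (hd : 1 ≤ d) (k : W) {ε : ℝ} (hε : 0 < ε) :
    eta H lam ^ d / partitionFn (completeBipartiteGraph (Fin d) (Fin d)) H lam *
        (1 - 1 / (d * ε ^ 2)) ≤
      prob (completeBipartiteGraph (Fin d) (Fin d)) H lam
        fun f => |prop k f - pairValue lam k P / (2 * eta H lam)| ≤ ε := by
  classical
  have : Nonempty (Fin d ⊕ Fin d) := ⟨.inl ⟨0, hd⟩⟩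
  have hd' : (0 : ℝ) < d := by exact_mod_cast hd
  have hp : eta H lam ^ d ≠ 0 := (pow_pos hη d).ne'
  have hZ := partitionFn_nonneg (completeBipartiteGraph (Fin d) (Fin d)) H hlam
  have key := one_sub_le_sum_prod (ι := Fin d ⊕ Fin d) (q := boxWeight lam P)
    (X := fun _ x => if x = k then 1 else 0) (boxWeight_nonneg hlam)
    (sum_boxWeight hη hlam hP) (fun _ x => by split_ifs <;> norm_num)
    (fun _ x => by split_ifs <;> norm_num) hε
  rw [average_boxWeight hη hlam hP hd] at key
  -- The graph has $2d$ vertices; the factor 2 is given up so that $\varepsilon=d^{-1/3}$ fits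
  -- exactly.
  have hcard : 1 - 1 / (d * ε ^ 2) ≤
      1 - 1 / ((Fintype.card (Fin d ⊕ Fin d) : ℕ) * ε ^ 2 : ℝ) := by
    refine sub_le_sub_left (one_div_le_one_div_of_le (by positivity) ?_) _
    refine mul_le_mul_of_nonneg_right ?_ (by positivity)
    simp
  refine (mul_le_mul_of_nonneg_left (hcard.trans key)
    (div_nonneg (pow_pos hη d).le hZ)).trans ?_
  rw [prob_eq_sum_gibbs, Finset.mul_sum]
  refine Finset.sum_le_sum fun f _ => ?_
  rw [prod_boxWeight hP, prop_eq]
  have e : ∀ v, (@ite ℝ (f v = k) (Classical.propDecidable _) 1 0) = if f v = k then 1 else 0 :=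
    fun v => by congr
  simp only [e]
  have g0 := gibbs_nonneg (completeBipartiteGraph (Fin d) (Fin d)) H hlam f
  split_ifs with h1 h2
  · rw [gibbs, if_pos (mem_homs_of_mem_box (mem_maxPairs.1 hP).1 h2)]
    refine le_of_eq ?_
    field_simp
  · simpa using g0
  · simp

end Boxes

/-! ### Asymptotics for $K_{d,d}$ -/

section Limits

variable {W : Type*} [Fintype W] {H : LoopGraph W} {lam : W → ℝ}

theorem tendsto_partitionFn_div (hη : 0 < eta H lam) (hlam : ∀ i, 0 < lam i) :
    Tendsto (fun d : ℕ => partitionFn (completeBipartiteGraph (Fin d) (Fin d)) H lam /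
      eta H lam ^ d) atTop (𝓝 (maxPairs H lam).card) := by
  classical
  have := tendsto_sum_homs_div (H := H) (lam := lam) (h := fun _ _ => 1) hη hlam (by simp) (by simp)
    (a := (maxPairs H lam).card) (fun d _ => by
      simp only [mul_one, sum_box_weight]
      rw [Finset.sum_congr rfl fun P hP => by rw [(mem_maxPairs.1 hP).2]]
      simp)
  simpa only [mul_one, partitionFn] using this

/-- The limit of the mean proportion in `K_{d,d}`: the average over the maximising pairs. -/
noncomputable def aMean (H : LoopGraph W) (lam : W → ℝ) (k : W) : ℝ :=
  (∑ P ∈ maxPairs H lam, pairValue lam k P / (2 * eta H lam)) / (maxPairs H lam).card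

theorem tendsto_meanProp (hη : 0 < eta H lam) (hlam : ∀ i, 0 < lam i) (k : W) :
    Tendsto (fun d : ℕ => meanProp (completeBipartiteGraph (Fin d) (Fin d)) H lam k) atTop
      (𝓝 (aMean H lam k)) := by
  classical
  have := tendsto_sum_homs_div (H := H) (lam := lam) (h := fun _ => prop k) hη hlam
    (fun _ => prop_nonneg k) (fun _ => prop_le_one k)
    (a := ∑ P ∈ maxPairs H lam, pairValue lam k P / (2 * eta H lam)) (fun d hd => by
      rw [Finset.sum_congr rfl fun P hP => sum_box_weight_mul_prop hη hlam hP hd k,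
        Finset.sum_mul])
  have hM : ((maxPairs H lam).card : ℝ) ≠ 0 := by
    exact_mod_cast (maxPairs_nonempty H lam).card_pos.ne'
  refine (this.div (tendsto_partitionFn_div hη hlam) hM).congr fun d => ?_
  rw [Pi.div_apply, div_div_div_cancel_right₀ (pow_pos hη d).ne', meanProp_eq_sum_gibbs, sum_gibbs_mul]

theorem aMinus_le_aMean (hη : 0 < eta H lam) (k : W) : aMinus H lam k ≤ aMean H lam k := by
  have hM : (0 : ℝ) < (maxPairs H lam).card := by
    exact_mod_cast (maxPairs_nonempty H lam).card_pos
  rw [aMean, le_div_iff₀ hM, mul_comm, ← nsmul_eq_mul]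
  exact Finset.card_nsmul_le_sum _ _ _ fun P hP =>
    div_le_div_of_nonneg_right (Finset.inf'_le _ hP) (by positivity)

theorem aMean_le_aPlus (hη : 0 < eta H lam) (k : W) : aMean H lam k ≤ aPlus H lam k := by
  have hM : (0 : ℝ) < (maxPairs H lam).card := by
    exact_mod_cast (maxPairs_nonempty H lam).card_pos
  rw [aMean, div_le_iff₀ hM, mul_comm _ ((maxPairs H lam).card : ℝ), ← nsmul_eq_mul]
  exact Finset.sum_le_card_nsmul _ _ _ fun P hP =>
    div_le_div_of_nonneg_right (Finset.le_sup' _ hP) (by positivity)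

theorem partitionFn_completeBipartiteGraph_pos (hη : 0 < eta H lam) (hlam : ∀ i, 0 < lam i)
    (d : ℕ) : 0 < partitionFn (completeBipartiteGraph (Fin d) (Fin d)) H lam := by
  obtain ⟨P, hP⟩ := maxPairs_nonempty H lam
  classical
  have := sum_box_weight (lam := lam) (d := d) P
  rw [(mem_maxPairs.1 hP).2] at this
  refine (this ▸ pow_pos hη d).trans_le
    (Finset.sum_le_sum_of_subset_of_nonneg (fun f hf => ?_) fun f _ _ => (weight_pos hlam f).le)
  exact mem_homs_of_mem_box (mem_maxPairs.1 hP).1 hf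

end Limits

/-! ### Regularity and bipartiteness -/

section Regular

theorem isRegularBipartite_completeBipartiteGraph {d : ℕ} (hd : 1 ≤ d) :
    IsRegularBipartite (completeBipartiteGraph (Fin d) (Fin d)) d := by
  classical
  refine ⟨⟨.inl ⟨0, hd⟩⟩, ?_, ?_⟩
  · exact ⟨SimpleGraph.Coloring.mk (fun v => Sum.elim (fun _ => 0) (fun _ => 1) v)
      (by rintro (i | i) (j | j) <;> simp)⟩
  · have hl : ∀ i, (completeBipartiteGraph (Fin d) (Fin d)).neighborSet (.inl i) =
        Set.range Sum.inr := fun i => by ext (j | j) <;> simp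
    have hr : ∀ i, (completeBipartiteGraph (Fin d) (Fin d)).neighborSet (.inr i) =
        Set.range Sum.inl := fun i => by ext (j | j) <;> simp
    rintro (i | i) <;> rw [← SimpleGraph.card_neighborSet_eq_degree, ← Nat.card_eq_fintype_card]
    · rw [hl, Nat.card_range_of_injective Sum.inr_injective, Nat.card_fin]
    · rw [hr, Nat.card_range_of_injective Sum.inl_injective, Nat.card_fin]

theorem IsRegularBipartite.boxProd_bot {ι U : Type*} [Fintype ι] [Fintype U] [Nonempty ι]
    {G : SimpleGraph U} {d : ℕ} (hG : IsRegularBipartite G d) :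
    IsRegularBipartite ((⊥ : SimpleGraph ι) □ G) d := by
  classical
  obtain ⟨hU, ⟨c⟩, hd⟩ := hG
  refine ⟨inferInstance, ⟨SimpleGraph.Coloring.mk (fun v => c v.2) ?_⟩, fun v => ?_⟩
  · intro u v huv
    simp only [SimpleGraph.boxProd_adj, SimpleGraph.bot_adj, false_and, false_or] at huv
    exact c.valid huv.1
  · have := SimpleGraph.degree_boxProd (G := (⊥ : SimpleGraph ι)) (H := G) v
    rw [SimpleGraph.bot_degree, zero_add] at this
    rw [← hd v.2]
    convert this

end Regular

end HColouring

/-! ### Assembling the two families -/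

open HColouring in
theorem theorem1p4 {W : Type*} [Fintype W] (H : LoopGraph W) (hH : ∃ i j, H.Adj i j)
    (lam : W → ℝ) (hlam : ∀ i, 0 < lam i) :
    (∃ (V : ℕ → Type) (_ : ∀ d, Fintype (V d)) (G : ∀ d, SimpleGraph (V d))
        (g : ℕ → ℝ) (c : ℝ),
      (∀ d, 1 ≤ d → HColouring.IsRegularBipartite (G d) d) ∧
      Tendsto g atTop (𝓝 0) ∧ 0 < c ∧
      ∀ k : W, ∀ d, 1 ≤ d →
        c - g d ≤ HColouring.prob (G d) H lam
          (fun f => |HColouring.prop k f - HColouring.aPlus H lam k| ≤ g d) ∧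
        c - g d ≤ HColouring.prob (G d) H lam
          (fun f => |HColouring.prop k f - HColouring.aMinus H lam k| ≤ g d)) ∧
    (∃ (V : ℕ → Type) (_ : ∀ d, Fintype (V d)) (G' : ∀ d, SimpleGraph (V d))
        (g : ℕ → ℝ) (a : W → ℝ),
      (∀ d, 1 ≤ d → HColouring.IsRegularBipartite (G' d) d) ∧
      Tendsto g atTop (𝓝 0) ∧
      (∀ k : W, HColouring.aMinus H lam k ≤ a k ∧ a k ≤ HColouring.aPlus H lam k) ∧
      ∀ k : W, ∀ d, 1 ≤ d →
        1 - g d ≤ HColouring.prob (G' d) H lam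
          (fun f => |HColouring.prop k f - a k| ≤ g d) ∧
        |HColouring.meanProp (G' d) H lam k - a k| ≤ g d) := by
  classical
  have hη := eta_pos hH hlam
  have hM : (0 : ℝ) < (maxPairs H lam).card := by
    exact_mod_cast (maxPairs_nonempty H lam).card_pos
  -- Moving the centre of the interval from `a` to `b` costs $|a-b|$ in radius.
  have mono : ∀ {V : Type} [Fintype V] (G : SimpleGraph V) (k : W) (a b ε δ : ℝ),
      ε + |a - b| ≤ δ → prob G H lam (fun f => |prop k f - a| ≤ ε) ≤
        prob G H lam (fun f => |prop k f - b| ≤ δ) := by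
    intro V _ G k a b ε δ h
    rw [prob_eq_sum_gibbs, prob_eq_sum_gibbs]
    refine Finset.sum_le_sum fun f _ => ?_
    have := gibbs_nonneg G H hlam f
    split_ifs with h1 h2 h2
    · exact le_rfl
    · exact absurd ((abs_sub_le _ a _).trans ((add_le_add_left h1 _).trans h)) h2
    · exact this
    · exact le_rfl
  have hZ := partitionFn_completeBipartiteGraph_pos hη hlam
  have hε : ∀ d : ℕ, 1 ≤ d → 0 < (d : ℝ) ^ (-(1 / 3) : ℝ) := fun d hd =>
    Real.rpow_pos_of_pos (by exact_mod_cast hd) _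
  constructor
  · set r : ℕ → ℝ := fun d =>
      eta H lam ^ d / partitionFn (completeBipartiteGraph (Fin d) (Fin d)) H lam with hr
    have hr0 : ∀ d, 0 ≤ r d := fun d => div_nonneg (pow_pos hη d).le (hZ d).le
    have hrt : Tendsto r atTop (𝓝 (1 / (maxPairs H lam).card)) := by
      rw [one_div]
      refine ((tendsto_partitionFn_div hη hlam).inv₀ hM.ne').congr fun d => ?_
      rw [inv_div]
    refine ⟨fun d => Fin d ⊕ Fin d, fun d => inferInstance,
      fun d => completeBipartiteGraph (Fin d) (Fin d),
      -- The three terms are the radius, the Chebyshev loss inside the box, and the distance of the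
      -- box's relative weight `r d` from its limit `c`.
      fun d => (d : ℝ) ^ (-(1 / 3) : ℝ) + (r d * (d : ℝ) ^ (-(1 / 3) : ℝ) +
        |r d - 1 / (maxPairs H lam).card|), 1 / (maxPairs H lam).card,
      fun d hd => isRegularBipartite_completeBipartiteGraph hd, ?_, by positivity, ?_⟩
    · have h1 := hrt.mul tendsto_rpow_neg_third
      have h2 := (hrt.sub_const (1 / ((maxPairs H lam).card : ℝ))).abs
      simpa using tendsto_rpow_neg_third.add (h1.add h2)
    · intro k d hd
      have bound : ∀ P ∈ maxPairs H lam, 1 / ((maxPairs H lam).card : ℝ) -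
          ((d : ℝ) ^ (-(1 / 3) : ℝ) + (r d * (d : ℝ) ^ (-(1 / 3) : ℝ) +
            |r d - 1 / (maxPairs H lam).card|)) ≤
          prob (completeBipartiteGraph (Fin d) (Fin d)) H lam
            fun f => |prop k f - pairValue lam k P / (2 * eta H lam)| ≤
              (d : ℝ) ^ (-(1 / 3) : ℝ) + (r d * (d : ℝ) ^ (-(1 / 3) : ℝ) +
                |r d - 1 / (maxPairs H lam).card|) := by
        intro P hP
        have h1 := sub_le_prob_completeBipartiteGraph hη hlam hP hd k (hε d hd)
        rw [rpow_neg_third_spec (by exact_mod_cast hd)] at h1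
        have h3 := mul_nonneg (hr0 d) (hε d hd).le
        refine le_trans ?_ (h1.trans (mono _ _ _ _ _ _ ?_))
        · have h2 := neg_abs_le (r d - 1 / (maxPairs H lam).card)
          have h4 := hε d hd
          change _ ≤ r d * _
          linarith
        · rw [sub_self, abs_zero]
          have h2 := abs_nonneg (r d - 1 / (maxPairs H lam).card)
          linarith
      obtain ⟨P, hP, hPe⟩ := Finset.exists_mem_eq_sup' (maxPairs_nonempty H lam) (pairValue lam k)
      obtain ⟨Q, hQ, hQe⟩ := Finset.exists_mem_eq_inf' (maxPairs_nonempty H lam) (pairValue lam k)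
      rw [aPlus, aMinus, hPe, hQe]
      exact ⟨bound P hP, bound Q hQ⟩
  -- Summing over the colours gives one error that serves every `k`.
  · set e : ℕ → ℝ := fun d => ∑ k : W,
      |meanProp (completeBipartiteGraph (Fin d) (Fin d)) H lam k - aMean H lam k| with he
    have het : Tendsto e atTop (𝓝 0) := by
      rw [← Finset.sum_const_zero (s := (Finset.univ : Finset W))]
      refine tendsto_finsetSum _ fun k _ => ?_
      simpa using ((tendsto_meanProp hη hlam k).sub_const (aMean H lam k)).abs
    have hek : ∀ d k, |meanProp (completeBipartiteGraph (Fin d) (Fin d)) H lam k -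
        aMean H lam k| ≤ e d := fun d k =>
      Finset.single_le_sum (f := fun k =>
        |meanProp (completeBipartiteGraph (Fin d) (Fin d)) H lam k - aMean H lam k|)
        (fun _ _ => abs_nonneg _) (Finset.mem_univ k)
    -- Any number of copies tending to infinity would do; with `d` of them the error is again
    -- $d^{-1/3}$.
    refine ⟨fun d => Fin d × (Fin d ⊕ Fin d), fun d => inferInstance,
      fun d => (⊥ : SimpleGraph (Fin d)) □ completeBipartiteGraph (Fin d) (Fin d),
      fun d => (d : ℝ) ^ (-(1 / 3) : ℝ) + e d, aMean H lam, fun d hd => ?_, ?_,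
      fun k => ⟨aMinus_le_aMean hη k, aMean_le_aPlus hη k⟩, fun k d hd => ?_⟩
    · have : Nonempty (Fin d) := ⟨⟨0, hd⟩⟩
      exact (isRegularBipartite_completeBipartiteGraph hd).boxProd_bot
    · simpa using tendsto_rpow_neg_third.add het
    · have : Nonempty (Fin d) := ⟨⟨0, hd⟩⟩
      have h4 := hε d hd
      have h5 := hek d k
      constructor
      · have h1 := one_sub_le_prob_boxProd_bot (ι := Fin d)
          (completeBipartiteGraph (Fin d) (Fin d)) H hlam (hZ d).ne' k (hε d hd)
        rw [Fintype.card_fin, rpow_neg_third_spec (by exact_mod_cast hd)] at h1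
        refine le_trans ?_ (h1.trans (mono _ _ _ _ _ _ (add_le_add_right h5 _)))
        linarith [(abs_nonneg _).trans h5]
      · rw [meanProp_boxProd_bot _ _ (hZ d).ne']
        linarith
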